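/- A gyrogroup is a magma $(G,\oplus)$ with an element $0$ such that $0\oplus a=a$ for all $a$, every $a$ has some $b$ with $b\oplus a=0$, and for all $a,b\in G$ there is an automorphism $\mathrm{gyr}[a,b]$ of $(G,\oplus)$ with $a\oplus(b\oplus c)=(a\oplus b)\oplus\mathrm{gyr}[a,b]c$ for all $c$ and $\mathrm{gyr}[a,b]=\mathrm{gyr}[a\oplus b,b]$. It is gyrocommutative if $a\oplus b=\mathrm{gyr}[a,b](b\oplus a)$ for all $a,b$, and nongyrocommutative otherwise. A subgyrogroup of $G$ is a nonempty subset $H$ that is a gyrogroup under the inherited operation and such that, for all $a,b\in H$, $\mathrm{gyr}[a,b]$ restricts to an automorphism of $H$. The order of an element $a$ is the cardinality of the subgyrogroup $\langle a\rangle$ generated by $a$, that is, of the intersection of all subgyrogroups containing $a$. A finite gyrogroup $G$ has the weak Cauchy property if for every prime $q$ dividing $|G|$ it has an element of order $q$; it has the strong Cauchy property if every subgyrogroup of $G$ has the weak Cauchy property. **Theorem.** Let $p$ be a prime. Every nongyrocommutative gyrogroup of order $p^3$ has the strong Cauchy property. -/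

import Mathlib

universe u

/-- A gyrogroup: a magma `(G, +)` with a left identity `0`, left inverses `-a`, and for all `a b`
an automorphism `gyr a b` of the magma satisfying the left gyroassociative law and the left loop
property. (The data `0`, `-` and `gyr` are determined by the operation `+`.) -/
class Gyrogroup (G : Type u) extends Add G, Zero G, Neg G where
  gyr : G → G → (G ≃+ G)
  zero_add' : ∀ a : G, 0 + a = a
  neg_add' : ∀ a : G, -a + a = 0
  gyroassoc : ∀ a b c : G, a + (b + c) = (a + b) + gyr a b c
  left_loop : ∀ a b : G, gyr a b = gyr (a + b) b

namespace Gyrogroup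

variable {G : Type u} [Gyrogroup G]

theorem left_cancel {a b c : G} (h : a + b = a + c) : b = c := by
  have h1 : ∀ x : G, -a + (a + x) = gyr (-a) a x := fun x => by
    rw [gyroassoc, neg_add', zero_add']
  have h2 := h1 b
  rw [h, h1 c] at h2
  exact ((gyr (-a) a).injective h2).symm

theorem gyr_zero_left (a c : G) : gyr 0 a c = c := by
  have h := gyroassoc (0 : G) a c
  rw [zero_add', zero_add'] at h
  exact (left_cancel h).symm

theorem neg_add_cancel_left' (a b : G) : -a + (a + b) = b := by
  rw [gyroassoc, neg_add', zero_add', left_loop, neg_add', gyr_zero_left]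

theorem add_zero' (a : G) : a + 0 = a :=
  left_cancel (a := -a) (by rw [neg_add_cancel_left', neg_add'])

theorem add_neg' (a : G) : a + -a = 0 :=
  left_cancel (a := -a) (by rw [neg_add_cancel_left', add_zero'])

theorem eq_neg_of_add_eq_zero {n a : G} (h : n + a = 0) : n = -a := by
  have h1 : -n = a := by
    have h2 := neg_add_cancel_left' n a
    rwa [h, add_zero'] at h2
  apply left_cancel (a := a)
  rw [add_neg', ← h1, neg_add']

end Gyrogroup

open Gyrogroup in
/-- `G` is gyrocommutative: `a + b = gyr[a, b] (b + a)` for all `a`, `b`. -/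
def IsGyrocommutative (G : Type u) [Gyrogroup G] : Prop :=
  ∀ a b : G, a + b = gyr a b (b + a)

/-- A nonempty subset `H` of a gyrogroup `G` is a subgyrogroup if it is a gyrogroup under the
operation inherited from `G` and, for all `a b ∈ H`, the map `gyr a b` of `G` restricts to an
automorphism of `H` (additivity of the restriction being automatic). -/
structure IsSubgyrogroup {G : Type u} [Gyrogroup G] (H : Set G) : Prop where
  nonempty : H.Nonempty
  isGyrogroup : ∃ _ : Gyrogroup H, ∀ a b : H, ((a + b : H) : G) = (a : G) + (b : G)
  gyr_bijOn : ∀ a ∈ H, ∀ b ∈ H, Set.BijOn (Gyrogroup.gyr a b) H H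

namespace IsSubgyrogroup

variable {G : Type u} [Gyrogroup G] {H : Set G}

theorem add_mem (h : IsSubgyrogroup H) {a b : G} (ha : a ∈ H) (hb : b ∈ H) : a + b ∈ H := by
  obtain ⟨S, hS⟩ := h.isGyrogroup
  have h1 := hS ⟨a, ha⟩ ⟨b, hb⟩
  exact h1 ▸ Subtype.property _

theorem zero_mem (h : IsSubgyrogroup H) : (0 : G) ∈ H := by
  obtain ⟨S, hS⟩ := h.isGyrogroup
  have h1 := hS 0 0
  rw [Gyrogroup.zero_add'] at h1
  have h2 : ((0 : H) : G) = 0 :=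
    Gyrogroup.left_cancel (h1.symm.trans (Gyrogroup.add_zero' _).symm)
  exact h2 ▸ Subtype.property _

theorem neg_mem (h : IsSubgyrogroup H) {a : G} (ha : a ∈ H) : -a ∈ H := by
  obtain ⟨S, hS⟩ := h.isGyrogroup
  have h1 := hS 0 0
  rw [Gyrogroup.zero_add'] at h1
  have h2 : ((0 : H) : G) = 0 :=
    Gyrogroup.left_cancel (h1.symm.trans (Gyrogroup.add_zero' _).symm)
  have h3 := hS (-⟨a, ha⟩) ⟨a, ha⟩
  rw [Gyrogroup.neg_add', h2] at h3
  have h4 := Gyrogroup.eq_neg_of_add_eq_zero h3.symm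
  exact h4 ▸ Subtype.property _

/-- The operation that a subgyrogroup inherits from the ambient gyrogroup. -/
@[reducible] def toAdd (h : IsSubgyrogroup H) : Add H :=
  ⟨fun a b => ⟨(a : G) + (b : G), h.add_mem a.2 b.2⟩⟩

/-- The gyrogroup structure that a subgyrogroup inherits from the ambient gyrogroup. -/
@[reducible] noncomputable def toGyrogroup (h : IsSubgyrogroup H) : Gyrogroup H :=
  letI : Add H := h.toAdd
  { zero := ⟨0, h.zero_mem⟩
    neg := fun a => ⟨-(a : G), h.neg_mem a.2⟩
    gyr := fun a b =>
      { Set.BijOn.equiv (Gyrogroup.gyr (a : G) (b : G)) (h.gyr_bijOn a a.2 b b.2) with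
        map_add' := fun x y =>
          Subtype.ext (map_add (Gyrogroup.gyr (a : G) (b : G)) (x : G) (y : G)) }
    zero_add' := fun a => Subtype.ext (Gyrogroup.zero_add' (a : G))
    neg_add' := fun a => Subtype.ext (Gyrogroup.neg_add' (a : G))
    gyroassoc := fun a b c => Subtype.ext (Gyrogroup.gyroassoc (a : G) (b : G) (c : G))
    left_loop := fun a b => AddEquiv.ext fun c =>
      Subtype.ext (DFunLike.congr_fun (Gyrogroup.left_loop (a : G) (b : G)) (c : G)) }

end IsSubgyrogroup

/-- The subgyrogroup generated by `A`: the intersection of all subgyrogroups containing `A`. -/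
def gyroClosure {G : Type u} [Gyrogroup G] (A : Set G) : Set G :=
  ⋂₀ {H : Set G | IsSubgyrogroup H ∧ A ⊆ H}

/-- The order of an element `a`: the cardinality (possibly `∞`) of the subgyrogroup generated
by `a`. -/
noncomputable def gyroOrder {G : Type u} [Gyrogroup G] (a : G) : ℕ∞ :=
  (gyroClosure {a}).encard

/-- A finite gyrogroup has the weak Cauchy property if it has an element of order `q` for every
prime `q` dividing its order. -/
def HasWeakCauchyProperty (G : Type u) [Gyrogroup G] [Finite G] : Prop :=
  ∀ q : ℕ, q.Prime → q ∣ Nat.card G → ∃ a : G, gyroOrder a = (q : ℕ∞)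

/-- A finite gyrogroup has the strong Cauchy property if each of its subgyrogroups, with the
inherited structure, has the weak Cauchy property. -/
def HasStrongCauchyProperty (G : Type u) [Gyrogroup G] [Finite G] : Prop :=
  ∀ (H : Set G) (h : IsSubgyrogroup H), @HasWeakCauchyProperty H h.toGyrogroup _

/-!
The left translations `L a : x ↦ a + x` of a gyrogroup satisfy `L a * L b = L (a + b) * gyr a b`
and the left Bol identity `L a * L b * L a = L (a + (b + a))`. Hence `L a ^ n` is again a left
translation. A left translation with a fixed point is the identity, so the cyclic group generated
by `L a` acts freely. Therefore `⟨a⟩` is a cyclic group of the same order as `L a`, and this order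
divides the order of the gyrogroup; in a nontrivial gyrogroup of prime power order `p ^ k` a
suitable multiple of any nonzero element has order `p`
(`hasWeakCauchyProperty_of_card_dvd_prime_pow`).

It remains to show that the order of a subgyrogroup `H` of `G` divides `p ^ 3`
(`nat_card_subgyrogroup_dvd`). Consider the left nucleus `N`, realised as the group of
permutations `g` of `G` with `g * A = A`, where `A` is the set of left translations. The group `N`
is contained in `A`, acts freely on `G`, and is normalised by `A`. If it were trivial, then `G`
would be gyrocommutative (`isGyrocommutative_of_leftNucleus_eq_bot`): the Bol identity puts
`L (-a) * L (-b) * (gyr a b)⁻¹ * L (a + b)` in `N`. So the quotient of `G` by `N` has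
order dividing `p ^ 2`, and it inherits left translations closed under powers and, apart from
the identity, without fixed points. The order of `H` is the order of a subgroup of `N`
times the order of the image `K` of `H` in this quotient, so it suffices that `|K|` divides
`p ^ 2` (`IsPowerAlternative.card_subset_dvd_prime_sq`). Either `K` has an element of order
`p ^ 2`, and is everything, or all its nonneutral elements have order `p`. In that case `|K|` is
`1`, or a multiple `p * k ≤ p ^ 2` congruent to `1` modulo `p - 1`, which leaves `k = 1` and
`k = p`.
-/

open Equiv (Perm)

/-! ### Subgroups of a permutation group that act freely -/

section FreeAction

variable {X : Type*}

/-- If the elements of the freely acting group `Γ` that move some point of `S` into `S` are those of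
the subgroup `Δ`, then each orbit of `Γ` meeting `S` meets it in a free orbit of `Δ`. -/
theorem nat_card_eq_card_mul_card_image_orbits {Γ Δ : Subgroup (Perm X)} (hΔ : Δ ≤ Γ)
    (hfree : ∀ g ∈ Γ, ∀ x, g x = x → g = 1) {S : Set X}
    (hS : ∀ g ∈ Γ, ∀ s ∈ S, (g s ∈ S ↔ g ∈ Δ)) :
    Nat.card S = Nat.card Δ *
      Nat.card ((Quotient.mk (MulAction.orbitRel Γ X)) '' S) := by
  rw [← Nat.card_prod]
  have hrep : ∀ q : (Quotient.mk (MulAction.orbitRel Γ X)) '' S,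
      ∃ s ∈ S, Quotient.mk (MulAction.orbitRel Γ X) s = q := fun q => q.2
  choose r hrS hrq using hrep
  refine (Nat.card_congr (Equiv.ofBijective (fun gq : Δ × _ =>
    (⟨gq.1.1 (r gq.2), (hS _ (hΔ gq.1.2) _ (hrS _)).2 gq.1.2⟩ : S)) ⟨?_, ?_⟩)).symm
  · rintro ⟨⟨g, hg⟩, q⟩ ⟨⟨g', hg'⟩, q'⟩ h
    have h1 : g (r q) = g' (r q') := congrArg Subtype.val h
    have h2 : q = q' := by
      apply Subtype.ext
      rw [← hrq q, ← hrq q']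
      apply Quotient.sound
      refine ⟨⟨g⁻¹ * g', Γ.mul_mem (Γ.inv_mem (hΔ hg)) (hΔ hg')⟩, ?_⟩
      change (g⁻¹ * g') (r q') = r q
      rw [Perm.mul_apply, ← h1, Equiv.Perm.inv_def, Equiv.symm_apply_apply]
    subst h2
    have h3 := hfree (g⁻¹ * g') (Γ.mul_mem (Γ.inv_mem (hΔ hg)) (hΔ hg')) (r q)
      (by rw [Perm.mul_apply, ← h1, Equiv.Perm.inv_def, Equiv.symm_apply_apply])
    have h4 : g = g' := inv_mul_eq_one.1 h3
    subst h4
    rfl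
  · rintro ⟨s, hs⟩
    let q : (Quotient.mk (MulAction.orbitRel Γ X)) '' S := ⟨_, s, hs, rfl⟩
    have hq : Quotient.mk (MulAction.orbitRel Γ X) s = Quotient.mk _ (r q) := (hrq q).symm
    obtain ⟨⟨g, hg⟩, hgs⟩ := Quotient.exact hq
    have hgs' : g (r q) = s := hgs
    have hgΔ : g ∈ Δ := (hS g hg (r q) (hrS q)).1 (hgs'.symm ▸ hs)
    exact ⟨(⟨g, hgΔ⟩, q), Subtype.ext hgs'⟩

theorem nat_card_eq_card_mul_card_orbits {Γ : Subgroup (Perm X)}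
    (hfree : ∀ g ∈ Γ, ∀ x, g x = x → g = 1) :
    Nat.card X = Nat.card Γ * Nat.card (Quotient (MulAction.orbitRel Γ X)) := by
  have h := nat_card_eq_card_mul_card_image_orbits le_rfl hfree (S := Set.univ)
    (fun g hg _ _ => by simp [hg])
  rwa [Set.image_univ, Set.range_eq_univ.2 Quotient.mk_surjective, Nat.card_univ,
    Nat.card_univ] at h

end FreeAction

/-! ### Sharply transitive families of permutations closed under powers -/

/-- The permutations `L a` of `Q` behave like the left translations of a left power alternative
loop with neutral element `o`: `L a` sends `o` to `a`, the powers of each `L a` belong to the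
family, and `L a` has no fixed point unless `a = o`. -/
structure IsPowerAlternative {Q : Type*} (L : Q → Perm Q) (o : Q) : Prop where
  apply_base : ∀ a, L a o = a
  pow_mem_range : ∀ a (n : ℕ), L a ^ n ∈ Set.range L
  eq_base_of_apply_eq : ∀ a x, L a x = x → a = o

namespace IsPowerAlternative

open scoped Pointwise

variable {Q : Type*} {L : Q → Perm Q} {o : Q}

theorem map_base (h : IsPowerAlternative L o) : L o = 1 := by
  obtain ⟨b, hb⟩ := h.pow_mem_range o 0
  rw [pow_zero] at hb
  have h1 := h.apply_base b
  rw [hb, Perm.one_apply] at h1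
  rw [h1, hb]

theorem injective (h : IsPowerAlternative L o) : Function.Injective L := fun a b hab => by
  rw [← h.apply_base a, ← h.apply_base b, hab]

theorem map_eq_one_iff (h : IsPowerAlternative L o) {a : Q} : L a = 1 ↔ a = o := by
  rw [← h.map_base, h.injective.eq_iff]

theorem pow_eq (h : IsPowerAlternative L o) (a : Q) (n : ℕ) : L a ^ n = L ((L a ^ n) o) := by
  obtain ⟨b, hb⟩ := h.pow_mem_range a n
  rw [← hb, h.apply_base]

theorem pow_eq_one_of_apply_eq (h : IsPowerAlternative L o) {a x : Q} {n : ℕ}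
    (hx : (L a ^ n) x = x) : L a ^ n = 1 := by
  obtain ⟨b, hb⟩ := h.pow_mem_range a n
  rw [← hb] at hx ⊢
  exact h.map_eq_one_iff.2 (h.eq_base_of_apply_eq b x hx)

theorem orderOf_dvd_card [Finite Q] (h : IsPowerAlternative L o) (a : Q) :
    orderOf (L a) ∣ Nat.card Q := by
  have hfree : ∀ g ∈ Subgroup.zpowers (L a), ∀ x, g x = x → g = 1 := by
    intro g hg x hx
    obtain ⟨n, rfl⟩ := mem_powers_iff_mem_zpowers.2 hg
    exact h.pow_eq_one_of_apply_eq hx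
  rw [nat_card_eq_card_mul_card_orbits hfree, Nat.card_zpowers]
  exact dvd_mul_right _ _

/-- The elements other than `o` are partitioned by the cyclic group which they generate; when
these groups all have order `p`, each part has `p - 1` elements. -/
theorem pred_dvd_card_pred [Finite Q] (h : IsPowerAlternative L o) {p : ℕ}
    (hord : ∀ a, a ≠ o → orderOf (L a) = p) : p - 1 ∣ Nat.card Q - 1 := by
  classical
  have := Fintype.ofFinite Q
  rw [Nat.card_eq_fintype_card, ← Finset.card_univ,
    ← Finset.card_erase_of_mem (Finset.mem_univ o),
    Finset.card_eq_sum_card_image fun a => Subgroup.zpowers (L a)]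
  refine Finset.dvd_sum fun Z hZ => ?_
  obtain ⟨a, ha, rfl⟩ := Finset.mem_image.1 hZ
  have hao : a ≠ o := Finset.ne_of_mem_erase ha
  have hcard : Set.ncard ((Subgroup.zpowers (L a) : Set (Perm Q)) \ {1}) = p - 1 := by
    rw [Set.ncard_sdiff_singleton_of_mem (one_mem _), ← Nat.card_coe_set_eq,
      ← hord a hao, ← Nat.card_zpowers]
    rfl
  rw [← hcard, ← Finset.card_image_of_injective _ h.injective, ← Set.ncard_coe_finset]
  apply dvd_of_eq
  congr 1
  ext g
  simp only [Set.mem_sdiff, SetLike.mem_coe, Set.mem_singleton_iff, Finset.coe_image,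
    Set.mem_image, Finset.coe_filter, Set.mem_ofPred_eq, Finset.mem_erase, Finset.mem_univ, and_true]
  constructor
  · rintro ⟨hg, hg1⟩
    obtain ⟨n, hn⟩ := mem_powers_iff_mem_zpowers.2 hg
    obtain ⟨b, hb⟩ := h.pow_mem_range a n
    have hbg : L b = g := hb.trans hn
    have hbo : b ≠ o := fun hbo => hg1 (by rw [← hbg, h.map_eq_one_iff.2 hbo])
    refine ⟨b, ⟨hbo, ?_⟩, hbg⟩
    apply Subgroup.eq_of_le_of_card_ge
    · rw [Subgroup.zpowers_le, hbg]
      exact hg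
    · rw [Nat.card_zpowers, Nat.card_zpowers, hord a hao, hord b hbo]
  · rintro ⟨b, ⟨hbo, hb⟩, rfl⟩
    exact ⟨hb ▸ Subgroup.mem_zpowers _, fun h1 => hbo (h.map_eq_one_iff.1 h1)⟩

/-- If some element has order `p ^ 2`, that order divides the cardinality; otherwise the
cardinality is divisible by `p` and congruent to `1` modulo `p - 1`. -/
theorem card_dvd_prime_sq [Finite Q] (h : IsPowerAlternative L o) {p : ℕ} (hp : p.Prime)
    (hord : ∀ a, orderOf (L a) ∣ p ^ 2) (hle : Nat.card Q ≤ p ^ 2) : Nat.card Q ∣ p ^ 2 := by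
  have hpos : 0 < Nat.card Q := Nat.card_pos_iff.2 ⟨⟨o⟩, inferInstance⟩
  by_cases h2 : ∃ a, orderOf (L a) = p ^ 2
  · obtain ⟨a, ha⟩ := h2
    exact dvd_of_eq (le_antisymm hle (Nat.le_of_dvd hpos (ha ▸ h.orderOf_dvd_card a)))
  have hone : ∀ a, a ≠ o → orderOf (L a) = p := by
    intro a hao
    obtain ⟨k, hk, hka⟩ := (Nat.dvd_prime_pow hp).1 (hord a)
    interval_cases k
    · exact absurd (h.map_eq_one_iff.1 (orderOf_eq_one_iff.1 hka)) hao
    · rwa [pow_one] at hka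
    · exact absurd ⟨a, hka⟩ h2
  by_cases h1 : ∃ a, a ≠ o
  · obtain ⟨a, ha⟩ := h1
    obtain ⟨k, hk⟩ := hone a ha ▸ h.orderOf_dvd_card a
    have hd := h.pred_dvd_card_pred hone
    rw [hk] at hd hle hpos ⊢
    have hp2 := hp.two_le
    have hk0 : 0 < k := Nat.pos_of_mul_pos_left hpos
    have hkp : k ≤ p := by
      rw [sq] at hle
      exact Nat.le_of_mul_le_mul_left hle hp.pos
    -- modulo `p - 1`, the cardinality `p * k` is `k`
    have hsplit : p * k - 1 = (p - 1) * k + (k - 1) := by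
      obtain ⟨m, rfl⟩ : ∃ m, p = m + 1 := ⟨p - 1, by omega⟩
      rw [Nat.add_sub_cancel, add_mul, one_mul]
      omega
    rw [hsplit] at hd
    have hd' : p - 1 ∣ k - 1 := (Nat.dvd_add_right (dvd_mul_right _ _)).1 hd
    rw [sq]
    apply Nat.mul_dvd_mul_left
    rcases Nat.eq_zero_or_pos (k - 1) with hk1 | hk1
    · rw [show k = 1 by omega]
      exact one_dvd _
    · have := Nat.le_of_dvd hk1 hd'
      rw [show k = p by omega]
  · push Not at h1
    have : Subsingleton Q := ⟨fun a b => (h1 a).trans (h1 b).symm⟩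
    rw [Nat.card_eq_one_iff_unique.2 ⟨this, ⟨o⟩⟩]
    exact one_dvd _

/-- A version of Lagrange's theorem: in a power alternative structure whose order divides `p ^ 2`,
the order of a closed subset divides `p ^ 2`. -/
theorem card_subset_dvd_prime_sq [Finite Q] (h : IsPowerAlternative L o) {p : ℕ} (hp : p.Prime)
    (hQ : Nat.card Q ∣ p ^ 2) {K : Set Q} (ho : o ∈ K) (hK : ∀ a ∈ K, ∀ b ∈ K, L a b ∈ K) :
    Nat.card K ∣ p ^ 2 := by
  have hmem : ∀ a : K, ∀ x, L a x ∈ K ↔ x ∈ K := fun a => by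
    have hs : L a ∈ MulAction.stabilizer (Perm Q) K :=
      (MulAction.mem_stabilizer_set' K.toFinite).2 fun b hb => hK a a.2 b hb
    exact fun x => MulAction.mem_stabilizer_set.1 hs x
  let M : K → Perm K := fun a => (L a).subtypePerm (hmem a)
  have hpow : ∀ (a : K) (n : ℕ) (x : K), ((M a ^ n) x : Q) = (L a ^ n) x := by
    intro a n x
    induction n with
    | zero => rfl
    | succ n ih =>
      rw [pow_succ', pow_succ', Perm.mul_apply, Perm.mul_apply, ← ih]
      rfl
  have hM : IsPowerAlternative M ⟨o, ho⟩ :=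
    { apply_base := fun a => Subtype.ext (h.apply_base a)
      pow_mem_range := fun a n => by
        refine ⟨(M a ^ n) ⟨o, ho⟩, Equiv.ext fun x => Subtype.ext ?_⟩
        rw [hpow, h.pow_eq, ← hpow a n ⟨o, ho⟩]
        rfl
      eq_base_of_apply_eq := fun a x hx =>
        Subtype.ext (h.eq_base_of_apply_eq a x (congrArg Subtype.val hx)) }
  refine hM.card_dvd_prime_sq hp (fun a => ?_) ?_
  · refine dvd_trans (orderOf_dvd_of_pow_eq_one (Equiv.ext fun x => Subtype.ext ?_))
      ((h.orderOf_dvd_card a).trans hQ)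
    rw [hpow, pow_orderOf_eq_one]
    rfl
  · exact (Nat.card_le_card_of_injective _ Subtype.val_injective).trans
      (Nat.le_of_dvd (pow_pos hp.pos 2) hQ)

end IsPowerAlternative

/-! ### Left translations of a gyrogroup -/

namespace Gyrogroup

open scoped Pointwise

variable {G : Type u} [Gyrogroup G]

theorem neg_neg' (a : G) : - -a = a := (eq_neg_of_add_eq_zero (add_neg' a)).symm

/-- Right translations are injective, since `a` is recovered from `a + b` and `b` by the left loop
property. -/
theorem add_add_gyr_neg (a b : G) : (a + b) + gyr (a + b) b (-b) = a := by
  rw [← left_loop, ← gyroassoc, add_neg', add_zero']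

/-- The left translation `x ↦ a + x`. -/
def leftTranslation (a : G) : Perm G where
  toFun x := a + x
  invFun x := -a + x
  left_inv := neg_add_cancel_left' a
  right_inv x := by
    have h := neg_add_cancel_left' (-a) x
    rwa [neg_neg'] at h

@[simp]
theorem leftTranslation_apply (a x : G) : leftTranslation a x = a + x := rfl

theorem leftTranslation_inv (a : G) : (leftTranslation a)⁻¹ = leftTranslation (-a) :=
  Equiv.ext fun _ => rfl

theorem leftTranslation_zero : leftTranslation (0 : G) = 1 := Equiv.ext zero_add'

/-- The gyration `gyr a b` as a permutation of `G`. -/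
def gyrPerm (a b : G) : Perm G := (gyr a b).toEquiv

@[simp]
theorem gyrPerm_apply (a b x : G) : gyrPerm a b x = gyr a b x := rfl

theorem leftTranslation_mul (a b : G) :
    leftTranslation a * leftTranslation b = leftTranslation (a + b) * gyrPerm a b :=
  Equiv.ext fun c => gyroassoc a b c

theorem gyrPerm_mul_leftTranslation (a b x : G) :
    gyrPerm a b * leftTranslation x = leftTranslation (gyr a b x) * gyrPerm a b :=
  Equiv.ext fun c => map_add (gyr a b) x c

theorem gyrPerm_loop (a b : G) : gyrPerm a b = gyrPerm (a + b) b := by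
  rw [gyrPerm, left_loop]
  rfl

/-- Comparing `L (-a) * L (a + b) = L b * gyr (-a) (a + b)` with the definition of `gyr a b` gives
`(gyr a b)⁻¹ = gyr (-a) (a + b)`, to which the left loop property applies. -/
theorem gyrPerm_inv (a b : G) : (gyrPerm a b)⁻¹ = gyrPerm b (a + b) := by
  have h1 : leftTranslation (-a) * leftTranslation (a + b)
      = leftTranslation b * gyrPerm (-a) (a + b) := by
    rw [leftTranslation_mul, neg_add_cancel_left']
  have h2 : leftTranslation (-a) * leftTranslation (a + b) =
      leftTranslation b * (gyrPerm a b)⁻¹ := by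
    rw [← leftTranslation_inv, inv_mul_eq_iff_eq_mul, ← mul_assoc, leftTranslation_mul, mul_assoc,
      mul_inv_cancel, mul_one]
  rw [mul_left_cancel (h2.symm.trans h1), gyrPerm_loop (-a), neg_add_cancel_left']

/-- The left Bol identity: left translations form a twisted subgroup of the symmetric group. -/
theorem leftTranslation_bol (a b : G) :
    leftTranslation a * leftTranslation b * leftTranslation a =
      leftTranslation (a + (b + a)) := by
  rw [mul_assoc, leftTranslation_mul b a, ← mul_assoc, leftTranslation_mul a (b + a),
    ← gyrPerm_inv b a, inv_mul_cancel_right]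

/-- The set of left translations of `G`. -/
def leftTranslations (G : Type u) [Gyrogroup G] : Set (Perm G) := Set.range leftTranslation

theorem one_mem_leftTranslations : (1 : Perm G) ∈ leftTranslations G := ⟨0, leftTranslation_zero⟩

theorem bol_mem_leftTranslations (a : G) {m : Perm G} (hm : m ∈ leftTranslations G) :
    leftTranslation a * m * leftTranslation a ∈ leftTranslations G := by
  obtain ⟨b, rfl⟩ := hm
  exact ⟨_, (leftTranslation_bol a b).symm⟩

theorem gyrPerm_inv_conj_mem_leftTranslations (a b : G) {m : Perm G}
    (hm : m ∈ leftTranslations G) : (gyrPerm a b)⁻¹ * m * gyrPerm a b ∈ leftTranslations G := by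
  obtain ⟨x, rfl⟩ := hm
  refine ⟨(gyr a b).symm x, ?_⟩
  rw [mul_assoc, eq_inv_mul_iff_mul_eq, gyrPerm_mul_leftTranslation, AddEquiv.apply_symm_apply]

theorem pow_mem_leftTranslations (a : G) (n : ℕ) :
    leftTranslation a ^ n ∈ leftTranslations G := by
  induction n using Nat.twoStepInduction with
  | zero => rw [pow_zero]; exact one_mem_leftTranslations
  | one => rw [pow_one]; exact ⟨a, rfl⟩
  | more n ih _ =>
    rw [pow_succ, pow_succ']
    exact bol_mem_leftTranslations a ih

theorem add_right_cancel' {a b x : G} (h : a + x = b + x) : a = b := by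
  rw [← add_add_gyr_neg a x, h, add_add_gyr_neg]

theorem eq_zero_of_add_eq_self {a x : G} (h : a + x = x) : a = 0 :=
  add_right_cancel' (h.trans (zero_add' x).symm)

theorem isPowerAlternative_leftTranslation :
    IsPowerAlternative (leftTranslation : G → Perm G) 0 where
  apply_base := add_zero'
  pow_mem_range := pow_mem_leftTranslations
  eq_base_of_apply_eq _ _ := eq_zero_of_add_eq_self

/-! ### The left nucleus -/

/-- The left nucleus of `G`, as the group of those permutations `g` for which `g * L` is a left
translation exactly when `L` is. -/
def leftNucleus (G : Type u) [Gyrogroup G] : Subgroup (Perm G) :=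
  MulAction.stabilizer (Perm G) (leftTranslations G)

theorem mul_mem_leftTranslations {g m : Perm G} (hg : g ∈ leftNucleus G)
    (hm : m ∈ leftTranslations G) : g * m ∈ leftTranslations G :=
  (MulAction.mem_stabilizer_set.1 hg m).2 hm

/-- The identity is a left translation, so `g = g * 1` is one for `g` in the left nucleus. -/
theorem leftNucleus_subset {g : Perm G} (hg : g ∈ leftNucleus G) : g ∈ leftTranslations G := by
  simpa using mul_mem_leftTranslations hg one_mem_leftTranslations

theorem eq_one_of_mem_leftNucleus {g : Perm G} (hg : g ∈ leftNucleus G) {x : G} (hx : g x = x) :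
    g = 1 := by
  obtain ⟨a, rfl⟩ := leftNucleus_subset hg
  rw [eq_zero_of_add_eq_self hx, leftTranslation_zero]

theorem mul_leftTranslation_eq {g : Perm G} (hg : g ∈ leftNucleus G) (a : G) :
    g * leftTranslation a = leftTranslation (g a) := by
  obtain ⟨b, hb⟩ := mul_mem_leftTranslations hg ⟨a, rfl⟩
  have h := DFunLike.congr_fun hb 0
  rw [leftTranslation_apply, add_zero', Perm.mul_apply, leftTranslation_apply, add_zero'] at h
  rw [← hb, h]

theorem mem_leftNucleus_of_forall [Finite G] {g : Perm G}
    (h : ∀ m ∈ leftTranslations G, g * m ∈ leftTranslations G) : g ∈ leftNucleus G :=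
  (MulAction.mem_stabilizer_set' (Set.toFinite _)).2 fun m hm => h m hm

/-- The left nucleus is normal: `L a * g * (L a)⁻¹ * m` is the two-sided multiple by `L a` of
`g * (L (-a) * m * L (-a))`. -/
theorem conj_mem_leftNucleus [Finite G] {g : Perm G} (hg : g ∈ leftNucleus G) (a : G) :
    leftTranslation a * g * (leftTranslation a)⁻¹ ∈ leftNucleus G := by
  refine mem_leftNucleus_of_forall fun m hm => ?_
  have h1 := bol_mem_leftTranslations a
    (mul_mem_leftTranslations hg (bol_mem_leftTranslations (-a) hm))
  rw [← leftTranslation_inv] at h1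
  convert h1 using 1
  group

/-- A gyrogroup with trivial left nucleus satisfies the automorphic inverse property, because the
defect of `L a * L b ↦ L (-a) * L (-b)` from being multiplicative lies in the left nucleus. -/
theorem isGyrocommutative_of_leftNucleus_eq_bot [Finite G] (h : leftNucleus G = ⊥) :
    IsGyrocommutative G := by
  intro a b
  have hab := leftTranslation_mul a b
  have hc : (leftTranslation a)⁻¹ * (leftTranslation b)⁻¹ * (gyrPerm a b)⁻¹ *
      leftTranslation (a + b) ∈ leftNucleus G := by
    refine mem_leftNucleus_of_forall fun m hm => ?_
    -- Two-sided multiplication by `L (a + b)`, conjugation by `(gyr a b)⁻¹` and two-sided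
    -- multiplication by `L (-b)` and `L (-a)` preserve the set of left translations; the factors
    -- accumulated on the right of `m` multiply to the identity.
    have h1 := bol_mem_leftTranslations (-a) (bol_mem_leftTranslations (-b)
      (gyrPerm_inv_conj_mem_leftTranslations a b (bol_mem_leftTranslations (a + b) hm)))
    rw [← leftTranslation_inv, ← leftTranslation_inv] at h1
    convert h1 using 1
    have h2 : leftTranslation (a + b) * gyrPerm a b * (leftTranslation b)⁻¹ *
        (leftTranslation a)⁻¹ = 1 := by
      rw [← hab]
      group
    calc _ = (leftTranslation a)⁻¹ * (leftTranslation b)⁻¹ * (gyrPerm a b)⁻¹ *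
          leftTranslation (a + b) * m * (leftTranslation (a + b) * gyrPerm a b *
            (leftTranslation b)⁻¹ * (leftTranslation a)⁻¹) := by rw [h2, mul_one, mul_assoc]
      _ = _ := by group
  rw [h, Subgroup.mem_bot] at hc
  have h3 : leftTranslation (a + b) = gyrPerm a b * (leftTranslation b * leftTranslation a) := by
    rw [eq_inv_of_mul_eq_one_right hc]
    group
  simpa [add_zero'] using DFunLike.congr_fun h3 0

/-! ### The quotient by the left nucleus -/

/-- The set of cosets of the left nucleus. -/
abbrev NucleusQuotient (G : Type u) [Gyrogroup G] : Type u :=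
  Quotient (MulAction.orbitRel (leftNucleus G) G)

/-- The coset of an element modulo the left nucleus. -/
def nucleusCoset (a : G) : NucleusQuotient G := Quotient.mk _ a

theorem nucleusCoset_eq_iff {x y : G} :
    nucleusCoset x = nucleusCoset y ↔ ∃ g ∈ leftNucleus G, g y = x :=
  Quotient.eq.trans ⟨fun ⟨g, hg⟩ => ⟨g, g.2, hg⟩, fun ⟨g, hg, h⟩ => ⟨⟨g, hg⟩, h⟩⟩

theorem nucleusCoset_add_eq [Finite G] (a : G) {x y : G} (h : nucleusCoset x = nucleusCoset y) :
    nucleusCoset (a + x) = nucleusCoset (a + y) := by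
  obtain ⟨g, hg, rfl⟩ := nucleusCoset_eq_iff.1 h
  refine nucleusCoset_eq_iff.2 ⟨_, conj_mem_leftNucleus hg a, ?_⟩
  rw [← leftTranslation_apply, Perm.mul_apply, Perm.mul_apply, Equiv.Perm.inv_def,
    Equiv.symm_apply_apply, leftTranslation_apply]

/-- The permutation of the cosets of the left nucleus induced by a left translation. -/
def cosetTranslation [Finite G] (a : G) : Perm (NucleusQuotient G) :=
  Quotient.congr (leftTranslation a) fun x y => by
    refine ⟨fun h => Quotient.exact (nucleusCoset_add_eq a (Quotient.sound h)), fun h => ?_⟩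
    have h1 := nucleusCoset_add_eq (-a) (Quotient.sound h)
    rw [leftTranslation_apply, leftTranslation_apply, neg_add_cancel_left',
      neg_add_cancel_left'] at h1
    exact Quotient.exact h1

theorem cosetTranslation_eq [Finite G] {a b : G} (h : nucleusCoset a = nucleusCoset b) :
    cosetTranslation a = cosetTranslation b := by
  obtain ⟨g, hg, rfl⟩ := nucleusCoset_eq_iff.1 h
  refine Equiv.ext fun q => Quotient.inductionOn q fun x => ?_
  refine nucleusCoset_eq_iff.2 ⟨g, hg, ?_⟩
  exact DFunLike.congr_fun (mul_leftTranslation_eq hg b) x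

/-- The left translations of the quotient of `G` by its left nucleus. -/
def quotientTranslation [Finite G] (q : NucleusQuotient G) : Perm (NucleusQuotient G) :=
  Quotient.lift cosetTranslation (fun _ _ h => cosetTranslation_eq (Quotient.sound h)) q

theorem quotientTranslation_coset [Finite G] (a x : G) :
    quotientTranslation (nucleusCoset a) (nucleusCoset x) = nucleusCoset (a + x) := rfl

theorem quotientTranslation_pow_coset [Finite G] (a x : G) (n : ℕ) :
    (quotientTranslation (nucleusCoset a) ^ n) (nucleusCoset x) =
      nucleusCoset ((leftTranslation a ^ n) x) := by
  induction n with
  | zero => rfl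
  | succ n ih =>
    rw [pow_succ', pow_succ', Perm.mul_apply, Perm.mul_apply, ih]
    rfl

theorem isPowerAlternative_quotientTranslation [Finite G] :
    IsPowerAlternative (quotientTranslation (G := G)) (nucleusCoset 0) where
  apply_base q := Quotient.inductionOn q fun a => congrArg nucleusCoset (add_zero' a)
  pow_mem_range q n := Quotient.inductionOn q fun a => by
    refine ⟨nucleusCoset ((leftTranslation a ^ n) 0),
      Equiv.ext fun r => Quotient.inductionOn r fun x => ?_⟩
    refine Eq.trans ?_ (quotientTranslation_pow_coset a x n).symm
    refine (quotientTranslation_coset _ x).trans (congrArg nucleusCoset ?_)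
    rw [isPowerAlternative_leftTranslation.pow_eq a n, leftTranslation_apply,
      leftTranslation_apply, add_zero']
  eq_base_of_apply_eq q r := Quotient.inductionOn₂ q r fun a x h => by
    obtain ⟨g, hg, hgx⟩ := nucleusCoset_eq_iff.1 h
    obtain ⟨n, rfl⟩ := leftNucleus_subset hg
    have hna : n = a := add_right_cancel' hgx
    subst hna
    exact nucleusCoset_eq_iff.2 ⟨_, hg, add_zero' n⟩

/-! ### Subgyrogroups -/

/-- A subgyrogroup splits into cosets of its intersection with the left nucleus, so its order is
the product of the orders of that intersection and of its image in the quotient. -/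
theorem nat_card_subgyrogroup_dvd [Finite G] {p : ℕ} (hp : p.Prime) (hcard : Nat.card G = p ^ 3)
    (hG : ¬ IsGyrocommutative G) {H : Set G} (hH : IsSubgyrogroup H) :
    Nat.card H ∣ p ^ 3 := by
  have hfree : ∀ g ∈ leftNucleus G, ∀ x, g x = x → g = 1 :=
    fun g hg x hx => eq_one_of_mem_leftNucleus hg hx
  have hGN := nat_card_eq_card_mul_card_orbits hfree
  rw [hcard] at hGN
  have hQ : Nat.card (NucleusQuotient G) ∣ p ^ 2 := by
    obtain ⟨k, hk, hNk⟩ := (Nat.dvd_prime_pow hp).1 ⟨_, hGN⟩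
    have hk0 : k ≠ 0 := by
      rintro rfl
      exact hG (isGyrocommutative_of_leftNucleus_eq_bot (Subgroup.card_eq_one.1 hNk))
    rw [hNk, show 3 = k + (3 - k) by omega, pow_add] at hGN
    rw [← Nat.eq_of_mul_eq_mul_left (pow_pos hp.pos k) hGN]
    exact pow_dvd_pow p (by omega)
  have hS : ∀ g ∈ leftNucleus G, ∀ s ∈ H,
      (g s ∈ H ↔ g ∈ leftNucleus G ⊓ MulAction.stabilizer (Perm G) H) := by
    intro g hg s hs
    refine ⟨fun hgs => ⟨hg, ?_⟩, fun h => (MulAction.mem_stabilizer_set.1 h.2 s).2 hs⟩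
    obtain ⟨n, rfl⟩ := leftNucleus_subset hg
    have hgs' : n + s ∈ H := hgs
    have hn : n ∈ H := by
      rw [← add_add_gyr_neg n s]
      exact hH.add_mem hgs' ((hH.gyr_bijOn _ hgs' _ hs).mapsTo (hH.neg_mem hs))
    exact (MulAction.mem_stabilizer_set' H.toFinite).2 fun x hx => hH.add_mem hn hx
  have hK := isPowerAlternative_quotientTranslation.card_subset_dvd_prime_sq hp hQ
    (K := nucleusCoset '' H) ⟨0, hH.zero_mem, rfl⟩ (by
      rintro _ ⟨a, ha, rfl⟩ _ ⟨b, hb, rfl⟩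
      exact ⟨a + b, hH.add_mem ha hb, rfl⟩)
  obtain ⟨i, -, hi⟩ := (Nat.dvd_prime_pow hp).1
    ((Subgroup.card_dvd_of_le
      (inf_le_left : leftNucleus G ⊓ MulAction.stabilizer (Perm G) H ≤ _)).trans ⟨_, hGN⟩)
  obtain ⟨j, -, hj⟩ := (Nat.dvd_prime_pow hp).1 hK
  have hHcard : Nat.card H = p ^ (i + j) := by
    rw [nat_card_eq_card_mul_card_image_orbits inf_le_left hfree hS, hi, pow_add, ← hj]
    rfl
  have hle : p ^ (i + j) ≤ p ^ 3 := by
    rw [← hHcard, ← hcard]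
    exact Nat.card_le_card_of_injective _ Subtype.val_injective
  rw [hHcard]
  exact pow_dvd_pow p ((Nat.pow_le_pow_iff_right hp.one_lt).1 hle)

/-! ### Cyclic subgyrogroups and Cauchy's theorem for prime powers -/

/-- The set of multiples of `a`, encoded as the orbit of `0` under the cyclic group generated by the
left translation by `a`. -/
def multiples (a : G) : Set G := (fun g : Perm G => g 0) '' (Subgroup.zpowers (leftTranslation a))

theorem gyr_eq_self_of_mul_eq {a b : G}
    (h : leftTranslation a * leftTranslation b = leftTranslation (a + b)) (c : G) :
    gyr a b c = c := by
  rw [leftTranslation_mul, mul_eq_left] at h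
  exact DFunLike.congr_fun h c

theorem leftTranslation_mem_zpowers [Finite G] {a x : G} (hx : x ∈ multiples a) :
    leftTranslation x ∈ Subgroup.zpowers (leftTranslation a) := by
  obtain ⟨g, hg, rfl⟩ := hx
  obtain ⟨n, rfl⟩ := mem_powers_iff_mem_zpowers.2 hg
  change leftTranslation ((leftTranslation a ^ n) 0) ∈ _
  rw [← isPowerAlternative_leftTranslation.pow_eq]
  exact hg

theorem mem_multiples_of_leftTranslation_mem {a x : G}
    (h : leftTranslation x ∈ Subgroup.zpowers (leftTranslation a)) : x ∈ multiples a :=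
  ⟨_, h, add_zero' x⟩

/-- The gyrations of multiples of `a` are trivial on the whole gyrogroup, so that the multiples of
`a` form a group. -/
theorem gyr_multiples [Finite G] {a x y : G} (hx : x ∈ multiples a) (hy : y ∈ multiples a)
    (c : G) : gyr x y c = c := by
  refine gyr_eq_self_of_mul_eq ?_ c
  obtain ⟨n, hn⟩ := mem_powers_iff_mem_zpowers.2
    (mul_mem (leftTranslation_mem_zpowers hx) (leftTranslation_mem_zpowers hy))
  change leftTranslation a ^ n = _ at hn
  rw [← hn, isPowerAlternative_leftTranslation.pow_eq, hn, Perm.mul_apply,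
    leftTranslation_apply, leftTranslation_apply, add_zero']

theorem add_mem_multiples [Finite G] {a x y : G} (hx : x ∈ multiples a) (hy : y ∈ multiples a) :
    x + y ∈ multiples a :=
  ⟨_, mul_mem (leftTranslation_mem_zpowers hx) (leftTranslation_mem_zpowers hy), by
    simp [add_zero']⟩

theorem isSubgyrogroup_multiples [Finite G] (a : G) : IsSubgyrogroup (multiples a) where
  nonempty := ⟨_, 1, one_mem _, rfl⟩
  isGyrogroup := by
    let _ : Add (multiples a) := ⟨fun x y => ⟨x + y, add_mem_multiples x.2 y.2⟩⟩
    exact ⟨{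
      zero := ⟨0, 1, one_mem _, rfl⟩
      neg := fun x => ⟨-x, mem_multiples_of_leftTranslation_mem
        (leftTranslation_inv (x : G) ▸ inv_mem (leftTranslation_mem_zpowers x.2))⟩
      gyr := fun _ _ => AddEquiv.refl _
      zero_add' := fun x => Subtype.ext (zero_add' (x : G))
      neg_add' := fun x => Subtype.ext (neg_add' (x : G))
      gyroassoc := fun x y z => Subtype.ext ((gyroassoc (x : G) y z).trans (by
        rw [gyr_multiples x.2 y.2]
        rfl))
      left_loop := fun _ _ => rfl }, fun _ _ => rfl⟩
  gyr_bijOn x hx y hy := by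
    have h : Set.EqOn id (gyr x y) (multiples a) := fun c _ => (gyr_multiples hx hy c).symm
    exact h.bijOn_iff.1 (Set.bijOn_id _)

theorem gyroClosure_singleton [Finite G] (a : G) : gyroClosure {a} = multiples a := by
  apply Set.Subset.antisymm
  · exact Set.sInter_subset_of_mem ⟨isSubgyrogroup_multiples a, Set.singleton_subset_iff.2
      (mem_multiples_of_leftTranslation_mem (Subgroup.mem_zpowers _))⟩
  · rintro _ ⟨g, hg, rfl⟩ H ⟨hH, haH⟩
    obtain ⟨n, rfl⟩ := mem_powers_iff_mem_zpowers.2 hg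
    change (leftTranslation a ^ n) 0 ∈ H
    clear hg
    induction n with
    | zero => exact hH.zero_mem
    | succ n ih =>
      rw [pow_succ', Perm.mul_apply]
      exact hH.add_mem (haH rfl) ih

theorem gyroOrder_eq_orderOf [Finite G] (a : G) :
    gyroOrder a = (orderOf (leftTranslation a) : ℕ∞) := by
  rw [gyroOrder, gyroClosure_singleton, multiples, Set.InjOn.encard_image, ← Nat.card_zpowers,
    ← Set.Finite.cast_ncard_eq (Set.toFinite _), ← Nat.card_coe_set_eq]
  · rfl
  · intro g hg g' hg' h
    obtain ⟨n, rfl⟩ := mem_powers_iff_mem_zpowers.2 hg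
    obtain ⟨m, rfl⟩ := mem_powers_iff_mem_zpowers.2 hg'
    change (leftTranslation a ^ n) 0 = (leftTranslation a ^ m) 0 at h
    change leftTranslation a ^ n = leftTranslation a ^ m
    rw [isPowerAlternative_leftTranslation.pow_eq, h, ← isPowerAlternative_leftTranslation.pow_eq]

theorem hasWeakCauchyProperty_of_card_dvd_prime_pow [Finite G] {p k : ℕ} (hp : p.Prime)
    (hcard : Nat.card G ∣ p ^ k) : HasWeakCauchyProperty G := by
  intro q hq hqG
  obtain rfl : q = p := (Nat.prime_dvd_prime_iff_eq hq hp).1 (hq.dvd_of_dvd_pow (hqG.trans hcard))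
  have : Nontrivial G := Finite.one_lt_card_iff_nontrivial.1
    (hq.one_lt.trans_le (Nat.le_of_dvd Nat.card_pos hqG))
  obtain ⟨b, hb⟩ := exists_ne (0 : G)
  obtain ⟨j, -, hj⟩ := (Nat.dvd_prime_pow hq).1
    ((isPowerAlternative_leftTranslation.orderOf_dvd_card b).trans hcard)
  have hqj : q ∣ orderOf (leftTranslation b) := by
    rw [hj]
    refine dvd_pow_self q ?_
    rintro rfl
    exact hb (isPowerAlternative_leftTranslation.map_eq_one_iff.1 (orderOf_eq_one_iff.1 hj))
  refine ⟨(leftTranslation b ^ (orderOf (leftTranslation b) / q)) 0, ?_⟩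
  rw [gyroOrder_eq_orderOf, ← isPowerAlternative_leftTranslation.pow_eq,
    orderOf_pow_orderOf_div (orderOf_pos _).ne' hqj]

end Gyrogroup

theorem mainTheorem4 {G : Type u} [Gyrogroup G] [Finite G] (p : ℕ) (hp : p.Prime)
    (hcard : Nat.card G = p ^ 3) (hG : ¬ IsGyrocommutative G) :
    HasStrongCauchyProperty G := fun _ h =>
  let _ := h.toGyrogroup
  Gyrogroup.hasWeakCauchyProperty_of_card_dvd_prime_pow hp
    (Gyrogroup.nat_card_subgyrogroup_dvd hp hcard hG h)
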